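/- Let $n \ge 0$ be an integer and let $i_0, j_0 \in \mathbb{Z}$. Consider the infinite square grid graph, whose vertices are the points $(a+\tfrac12, b+\tfrac12)$ with $(a,b)\in\mathbb{Z}^2$, whose edges join the vertices that differ by $(0,\pm1)$ or $(\pm1,0)$, and whose faces are the unit squares centred at the points $(i,j)\in\mathbb{Z}^2$. The Aztec diamond of order $n$ centred at $(i_0,j_0)$ is the subgraph of the grid induced on the set of vertices that lie on at least one face $(i,j)$ with $|i-i_0|+|j-j_0|<n$. A perfect matching of a graph is a set $M$ of edges such that each vertex lies on exactly one edge of $M$. Then the Aztec diamond of order $n$ centred at $(i_0,j_0)$ has exactly $2^{n(n+1)/2}$ perfect matchings. In particular, writing $g(n)$ for this number, $g(n)\,g(n-2)=2\,g(n-1)^2$ for all $n\ge 2$. -/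

import Mathlib

/-- The infinite square grid graph. The pair `(a, b)` of integers stands for the vertex at the
point `(a + 1/2, b + 1/2)` of the plane; two vertices are joined exactly when they differ by
`(0, ±1)` or `(±1, 0)`. -/
def squareGrid : SimpleGraph (ℤ × ℤ) where
  Adj p q := (p.1 = q.1 ∧ (q.2 = p.2 + 1 ∨ p.2 = q.2 + 1)) ∨
    (p.2 = q.2 ∧ (q.1 = p.1 + 1 ∨ p.1 = q.1 + 1))
  symm := ⟨by intro p q h; omega⟩
  loopless := ⟨by intro p h; omega⟩

/-- The four vertices of the face `f = (i, j)` of the square grid, that is of the unit square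
centred at `(i, j)`: these are the points `(i ± 1/2, j ± 1/2)`. -/
def faceVertices (f : ℤ × ℤ) : Set (ℤ × ℤ) :=
  {v | (v.1 = f.1 ∨ v.1 = f.1 - 1) ∧ (v.2 = f.2 ∨ v.2 = f.2 - 1)}

/-- The closed faces `(i, j)`, `|i - i₀| + |j - j₀| < n`, of the Aztec diamond of order `n`
centred at `(i₀, j₀)`. -/
def aztecFaces (n : ℕ) (i₀ j₀ : ℤ) : Set (ℤ × ℤ) :=
  {f | |f.1 - i₀| + |f.2 - j₀| < (n : ℤ)}

/-- The vertices of the square grid that lie on one of the faces in `aztecFaces n i₀ j₀`. -/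
def aztecVertices (n : ℕ) (i₀ j₀ : ℤ) : Set (ℤ × ℤ) :=
  {v | ∃ f ∈ aztecFaces n i₀ j₀, v ∈ faceVertices f}

/-- The Aztec diamond of order `n` centred at `(i₀, j₀)`: the subgraph of the square grid induced
on the vertices that lie on one of its closed faces. -/
def aztecDiamond (n : ℕ) (i₀ j₀ : ℤ) : SimpleGraph (aztecVertices n i₀ j₀) :=
  squareGrid.induce (aztecVertices n i₀ j₀)

/-- The number of perfect matchings of the Aztec diamond of order `n` centred at `(i₀, j₀)`. -/
noncomputable def aztecMatchingCount (n : ℕ) (i₀ j₀ : ℤ) : ℕ :=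
  {M : (aztecDiamond n i₀ j₀).Subgraph | M.IsPerfectMatching}.ncard

/-! Alternate faces of the order-`n` diamond form `n ^ 2` four-cycles (cells) that partition its
edges. A vertex is a corner of two cells if it lies in the concentric diamond of order `n - 1`, and
of one cell otherwise.

Sort matchings by the set of corners covered in each cell, and complement this set in every cell. A
perfect matching covers each vertex once, so after complementing, vertices of the smaller diamond
are covered `2 - 1 = 1` times and the others `1 - 1 = 0` times: these are the coverages by perfect
matchings of order `n - 1`. By `two_mul_cellWeight`, a cell contributes a factor `2` against `2` per
covered corner of one colour. That colour has `n * (n + 1)` vertices, so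
`two_pow_mul_card_cellMatchings` gives `2 ^ (n ^ 2) * g n = 2 ^ (n * (n + 1)) * g (n - 1)`, that is
`g n = 2 ^ n * g (n - 1)`. -/

/-- The sum of the values `g c a` over the corners `(c, a)` located at `v`. -/
def cornerSum {C α : Type*} [Fintype C] [DecidableEq α] (x : C → Bool → α) (g : C → Bool → ℕ)
    (v : α) : ℕ :=
  ∑ c, ∑ a, if x c a = v then g c a else 0

/-- The number of edges of the set `e` of edges of a four-cycle `K₂,₂` at a vertex of the first
side. -/
def rowDegree (e : Bool × Bool → Bool) (a : Bool) : ℕ := ∑ b, (e (a, b)).toNat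

/-- The number of edges of the set `e` of edges of a four-cycle `K₂,₂` at a vertex of the second
side. -/
def colDegree (e : Bool × Bool → Bool) (b : Bool) : ℕ := ∑ a, (e (a, b)).toNat

open Classical in
/-- The edge sets in a disjoint union of four-cycles indexed by `C`, whose corners are located at
`x` and `y`, with prescribed degrees `A` and `B` at every location. -/
noncomputable def cellMatchings {C α : Type*} [Fintype C] [DecidableEq α]
    (x y : C → Bool → α) (A B : α → ℕ) : Finset (C → Bool × Bool → Bool) :=
  {f | (∀ v, cornerSum x (fun c => rowDegree (f c)) v = A v) ∧
    ∀ v, cornerSum y (fun c => colDegree (f c)) v = B v}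

/-- The number of matchings of a four-cycle that cover precisely the corners in `k`. -/
def cellWeight (k : (Bool → Bool) × (Bool → Bool)) : ℕ :=
  Fintype.card {e : Bool × Bool → Bool //
    (∀ a, rowDegree e a = (k.1 a).toNat) ∧ ∀ b, colDegree e b = (k.2 b).toNat}

/-- The complementary set of corners. -/
def complCorners (k : (Bool → Bool) × (Bool → Bool)) : (Bool → Bool) × (Bool → Bool) :=
  (fun a => !k.1 a, fun b => !k.2 b)

lemma complCorners_involutive : Function.Involutive complCorners := by
  intro k; simp [complCorners]

-- The weight is `1` for no corners, `1` for the two ends of an edge, `2` for all four corners and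
-- `0` otherwise; the identity reads `2 * 1 = 1 * 2`, `2 * 1 = 2 * 1`, `2 * 2 = 4 * 1` or `0 = 0`.
set_option maxRecDepth 100000 in
lemma two_mul_cellWeight (k : (Bool → Bool) × (Bool → Bool)) :
    2 * cellWeight k = 2 ^ (∑ a, (k.1 a).toNat) * cellWeight (complCorners k) := by
  revert k; decide +kernel

/-! ### Counting by covered corners, and complementation. -/

section counting

variable {C α : Type*} [Fintype C] [DecidableEq α]

/-- The corners covered in the configuration `g` cover the location `v` exactly `A v` (`B v`)
times. -/
def IsCoverage (x y : C → Bool → α) (A B : α → ℕ) (g : C → (Bool → Bool) × (Bool → Bool)) :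
    Prop :=
  (∀ v, cornerSum x (fun c a => ((g c).1 a).toNat) v = A v) ∧
    ∀ v, cornerSum y (fun c b => ((g c).2 b).toNat) v = B v

lemma le_cornerSum (x : C → Bool → α) (g : C → Bool → ℕ) (c : C) (a : Bool) :
    g c a ≤ cornerSum x g (x c a) := by
  unfold cornerSum
  calc g c a = if x c a = x c a then g c a else 0 := by simp
    _ ≤ ∑ a', if x c a' = x c a then g c a' else 0 :=
      Finset.single_le_sum (f := fun a' => if x c a' = x c a then g c a' else 0)
        (fun _ _ => Nat.zero_le _) (Finset.mem_univ a)
    _ ≤ _ := Finset.single_le_sum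
        (f := fun c' => ∑ a', if x c' a' = x c a then g c' a' else 0)
        (fun _ _ => Nat.zero_le _) (Finset.mem_univ c)

lemma toNat_decide_eq_one {m : ℕ} (h : m ≤ 1) : (decide (m = 1)).toNat = m := by
  interval_cases m <;> rfl

-- The bounds on `A` and `B` force all degrees inside a cell to be `0` or `1`, so a set of covered
-- corners records them; once it is fixed, the cells are independent.
open Classical in
lemma card_cellMatchings (x y : C → Bool → α) (A B : α → ℕ)
    (hA : ∀ v, A v ≤ 1) (hB : ∀ v, B v ≤ 1) :
    (cellMatchings x y A B).card =
      ∑ g : C → (Bool → Bool) × (Bool → Bool),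
        if IsCoverage x y A B g then ∏ c, cellWeight (g c) else 0 := by
  rw [Finset.card_eq_sum_card_fiberwise (t := Finset.univ)
    (f := fun f c => (fun a => decide (rowDegree (f c) a = 1),
      fun b => decide (colDegree (f c) b = 1))) (fun _ _ => Finset.mem_coe.2 (Finset.mem_univ _))]
  refine Finset.sum_congr rfl fun g _ => ?_
  have key : ∀ f ∈ cellMatchings x y A B,
      (∀ c a, rowDegree (f c) a ≤ 1) ∧ ∀ c b, colDegree (f c) b ≤ 1 := by
    intro f hf
    simp only [cellMatchings, Finset.mem_filter, Finset.mem_univ, true_and] at hf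
    exact ⟨fun c a => (le_cornerSum x _ c a).trans ((hf.1 _).trans_le (hA _)),
      fun c b => (le_cornerSum y (fun c => colDegree (f c)) c b).trans
        ((hf.2 _).trans_le (hB _))⟩
  have hw : ∏ c, cellWeight (g c) = (Fintype.piFinset fun c =>
      ({e : Bool × Bool → Bool | (∀ a, rowDegree e a = ((g c).1 a).toNat) ∧
        ∀ b, colDegree e b = ((g c).2 b).toNat} : Finset _)).card := by
    rw [Fintype.card_piFinset]
    refine Finset.prod_congr rfl fun c _ => ?_
    rw [cellWeight, Fintype.card_subtype]
  have hiff : ∀ f, f ∈ cellMatchings x y A B ∧ (fun c => (fun a => decide (rowDegree (f c) a = 1),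
      fun b => decide (colDegree (f c) b = 1))) = g ↔
      IsCoverage x y A B g ∧ ∀ c, (∀ a, rowDegree (f c) a = ((g c).1 a).toNat) ∧
        ∀ b, colDegree (f c) b = ((g c).2 b).toNat := by
    intro f
    constructor
    · rintro ⟨hf, rfl⟩
      obtain ⟨h1, h2⟩ := key f hf
      simp only [cellMatchings, Finset.mem_filter, Finset.mem_univ, true_and] at hf
      simp only [IsCoverage, toNat_decide_eq_one (h1 _ _), toNat_decide_eq_one (h2 _ _)]
      exact ⟨hf, by simp⟩
    · rintro ⟨hg, h⟩
      have h1 := fun c => (h c).1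
      have h2 := fun c => (h c).2
      constructor
      · simp only [cellMatchings, Finset.mem_filter, Finset.mem_univ, true_and]
        have e1 : (fun c => rowDegree (f c)) = fun c a => ((g c).1 a).toNat := by
          ext c a; exact h1 c a
        have e2 : (fun c => colDegree (f c)) = fun c a => ((g c).2 a).toNat := by
          ext c a; exact h2 c a
        rw [e1, e2]
        exact hg
      · funext c
        refine Prod.ext (funext fun a => ?_) (funext fun b => ?_)
        · simp only [h1]; cases (g c).1 a <;> rfl
        · simp only [h2]; cases (g c).2 b <;> rfl
  split_ifs with hg
  · rw [hw]
    congr 1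
    ext f
    rw [Finset.mem_filter, hiff]
    simp [hg]
  · rw [Finset.card_eq_zero, Finset.filter_eq_empty_iff]
    intro f hf h
    exact hg ((hiff f).1 ⟨hf, h⟩).1

lemma cornerSum_add_cornerSum_not (x : C → Bool → α) (g : C → Bool → Bool) (v : α) :
    cornerSum x (fun c a => (g c a).toNat) v + cornerSum x (fun c a => (!g c a).toNat) v =
      cornerSum x (fun _ _ => 1) v := by
  simp only [cornerSum, ← Finset.sum_add_distrib]
  refine Finset.sum_congr rfl fun c _ => Finset.sum_congr rfl fun a _ => ?_
  cases g c a <;> split_ifs <;> rfl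

lemma sum_cornerSum (x : C → Bool → α) (g : C → Bool → ℕ) (U : Finset α)
    (hU : ∀ c a, x c a ∈ U) : ∑ v ∈ U, cornerSum x g v = ∑ c, ∑ a, g c a := by
  simp only [cornerSum]
  rw [Finset.sum_comm]
  refine Finset.sum_congr rfl fun c _ => ?_
  rw [Finset.sum_comm]
  refine Finset.sum_congr rfl fun a _ => ?_
  simp [hU]

/-- Complementing the covered corners in every four-cycle. -/
theorem two_pow_mul_card_cellMatchings (x y : C → Bool → α) (A B A' B' : α → ℕ)
    (hA : ∀ v, A v ≤ 1) (hB : ∀ v, B v ≤ 1) (hA' : ∀ v, A' v ≤ 1) (hB' : ∀ v, B' v ≤ 1)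
    (hx : ∀ v, A v + A' v = cornerSum x (fun _ _ => 1) v)
    (hy : ∀ v, B v + B' v = cornerSum y (fun _ _ => 1) v)
    (U : Finset α) (hU : ∀ c a, x c a ∈ U) :
    2 ^ Fintype.card C * (cellMatchings x y A B).card =
      2 ^ (∑ v ∈ U, A v) * (cellMatchings x y A' B').card := by
  classical
  rw [card_cellMatchings x y A B hA hB, card_cellMatchings x y A' B' hA' hB',
    ← (Equiv.piCongrRight fun _ : C => complCorners_involutive.toPerm).sum_comp
      (fun g => if IsCoverage x y A' B' g then ∏ c, cellWeight (g c) else 0),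
    Finset.mul_sum, Finset.mul_sum]
  refine Finset.sum_congr rfl fun g _ => ?_
  -- A configuration and its complement together cover `v` once per corner located there, which is
  -- `A v + A' v` times.
  have hiff : IsCoverage x y A' B'
      ((Equiv.piCongrRight fun _ : C => complCorners_involutive.toPerm) g) ↔
      IsCoverage x y A B g := by
    have h1 := fun v => cornerSum_add_cornerSum_not x (fun c => (g c).1) v
    have h2 := fun v => cornerSum_add_cornerSum_not y (fun c => (g c).2) v
    simp only [IsCoverage, Equiv.piCongrRight_apply, Pi.map_apply,
      Function.Involutive.coe_toPerm, complCorners]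
    refine and_congr (forall_congr' fun v => ?_) (forall_congr' fun v => ?_)
    · have := h1 v; have := hx v; omega
    · have := h2 v; have := hy v; omega
  rw [if_congr hiff rfl rfl]
  split_ifs with hg
  · have ht : ∑ v ∈ U, A v = ∑ c, ∑ a, ((g c).1 a).toNat := by
      rw [← sum_cornerSum x _ U hU]
      exact Finset.sum_congr rfl fun v _ => (hg.1 v).symm
    -- Both powers of two split as products over the cells, leaving the identity for a single cell.
    rw [ht, ← Finset.prod_pow_eq_pow_sum, ← Finset.prod_mul_distrib, ← Finset.card_univ,
      ← Finset.prod_const, ← Finset.prod_mul_distrib]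
    exact Finset.prod_congr rfl fun c _ => two_mul_cellWeight (g c)
  · simp

end counting

/-! ### Perfect matchings of a graph as edge sets in cells. -/

section graph

variable {C α : Type*} [Fintype C] [DecidableEq α]

lemma cornerSum_row_eq_card (x : C → Bool → α) (f : C → Bool × Bool → Bool) (v : α) :
    cornerSum x (fun c => rowDegree (f c)) v =
      Finset.card {t : C × Bool × Bool | x t.1 t.2.1 = v ∧ f t.1 t.2 = true} := by
  simp only [cornerSum, rowDegree, Finset.card_filter, Fintype.sum_prod_type]
  refine Finset.sum_congr rfl fun c _ => Finset.sum_congr rfl fun a _ => ?_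
  split_ifs with h
  · refine Finset.sum_congr rfl fun b _ => ?_
    cases f c (a, b) <;> simp [h]
  · simp [h]

lemma cornerSum_col_eq_card (y : C → Bool → α) (f : C → Bool × Bool → Bool) (v : α) :
    cornerSum y (fun c => colDegree (f c)) v =
      Finset.card {t : C × Bool × Bool | y t.1 t.2.2 = v ∧ f t.1 t.2 = true} := by
  simp only [cornerSum, colDegree, Finset.card_filter, Fintype.sum_prod_type]
  refine Finset.sum_congr rfl fun c _ => ?_
  rw [Finset.sum_comm (s := (Finset.univ : Finset Bool))]
  refine Finset.sum_congr rfl fun b _ => ?_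
  split_ifs with h
  · refine Finset.sum_congr rfl fun b _ => ?_
    simp only [h, true_and]
    cases f c _ <;> simp
  · simp [h]

/-- A unique-existence form of a prescribed cardinality `0` or `1`. -/
lemma card_eq_ite_iff {β : Type*} (s : Finset β) (p : Prop) [Decidable p] :
    s.card = (if p then 1 else 0) ↔ (p → ∃! t, t ∈ s) ∧ ∀ t ∈ s, p := by
  split_ifs with h
  · simp only [h, forall_const, implies_true, and_true]
    exact Finset.card_eq_one.trans (Finset.singleton_iff_unique_mem s)
  · simp [h, Finset.eq_empty_iff_forall_notMem]

lemma mem_cellMatchings_indicator (x y : C → Bool → α) (p q : α → Prop)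
    [DecidablePred p] [DecidablePred q]
    (f : C → Bool × Bool → Bool) :
    f ∈ cellMatchings x y (fun v => if p v then 1 else 0) (fun v => if q v then 1 else 0) ↔
      (∀ c a b, f c (a, b) = true → p (x c a) ∧ q (y c b)) ∧
      (∀ v, p v → ∃! t : C × Bool × Bool, x t.1 t.2.1 = v ∧ f t.1 t.2 = true) ∧
      (∀ v, q v → ∃! t : C × Bool × Bool, y t.1 t.2.2 = v ∧ f t.1 t.2 = true) := by
  simp only [cellMatchings, Finset.mem_filter, Finset.mem_univ, true_and, cornerSum_row_eq_card,
    cornerSum_col_eq_card, card_eq_ite_iff]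
  constructor
  · rintro ⟨h1, h2⟩
    exact ⟨fun c a b h => ⟨(h1 _).2 (c, a, b) ⟨rfl, h⟩, (h2 _).2 (c, a, b) ⟨rfl, h⟩⟩,
      fun v => (h1 v).1, fun v => (h2 v).1⟩
  · rintro ⟨h0, h1, h2⟩
    exact ⟨fun v => ⟨h1 v, fun ⟨c, a, b⟩ ⟨e, h⟩ => e ▸ (h0 c a b h).1⟩,
      fun v => ⟨h2 v, fun ⟨c, a, b⟩ ⟨e, h⟩ => e ▸ (h0 c a b h).2⟩⟩

open Classical in
/-- The perfect matchings of an induced subgraph whose edges are distributed over four-cycles. -/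
theorem ncard_perfectMatchings_induce (G : SimpleGraph α) (V : Set α) (P : α → Prop)
    (x y : C → Bool → α) (hx : ∀ c a, P (x c a)) (hy : ∀ c b, ¬ P (y c b))
    (hP : ∀ u w, G.Adj u w → (P u ↔ ¬ P w)) (hadj : ∀ c a b, G.Adj (x c a) (y c b))
    (hinj : ∀ c a b c' a' b', x c a = x c' a' → y c b = y c' b' → c = c' ∧ a = a' ∧ b = b')
    (hex : ∀ u ∈ V, ∀ w ∈ V, G.Adj u w → P u → ∃ c a b, x c a = u ∧ y c b = w) :
    {M : (G.induce V).Subgraph | M.IsPerfectMatching}.ncard =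
      Finset.card (cellMatchings x y (fun v => if v ∈ V ∧ P v then 1 else 0)
        (fun v => if v ∈ V ∧ ¬ P v then 1 else 0)) := by
  rw [← Set.ncard_coe_finset]
  -- By `hex` and `hinj`, every edge inside `V`, oriented from its `P` end, is named by exactly one
  -- triple `(c, a, b)`.
  refine Set.ncard_congr (fun M _ c e => decide (∃ (hu : x c e.1 ∈ V) (hw : y c e.2 ∈ V),
    M.Adj ⟨x c e.1, hu⟩ ⟨y c e.2, hw⟩)) ?_ ?_ ?_
  · intro M hM
    rw [Set.mem_ofPred_eq, SimpleGraph.Subgraph.isPerfectMatching_iff] at hM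
    rw [Finset.mem_coe, mem_cellMatchings_indicator]
    simp only [decide_eq_true_eq]
    refine ⟨fun c a b ⟨hu, hw, _⟩ => ⟨⟨hu, hx c a⟩, hw, hy c b⟩, ?_, ?_⟩
    · rintro v ⟨hv, hPv⟩
      obtain ⟨⟨w, hw⟩, hvw, huniq⟩ := hM ⟨v, hv⟩
      obtain ⟨c, a, b, rfl, rfl⟩ := hex v hv w hw hvw.adj_sub hPv
      refine ⟨(c, a, b), ⟨rfl, hv, hw, hvw⟩, ?_⟩
      rintro ⟨c', a', b'⟩ ⟨e, hu', hw', h⟩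
      simp only at e hu' hw' h
      simp only [e] at h
      have := congrArg Subtype.val (huniq _ h)
      obtain ⟨rfl, rfl, rfl⟩ := hinj _ _ _ _ _ _ e this
      rfl
    · rintro v ⟨hv, hPv⟩
      obtain ⟨⟨w, hw⟩, hvw, huniq⟩ := hM ⟨v, hv⟩
      have had := hvw.symm.adj_sub
      obtain ⟨c, a, b, rfl, rfl⟩ := hex w hw v hv had ((hP _ _ had).2 hPv)
      refine ⟨(c, a, b), ⟨rfl, hw, hv, hvw.symm⟩, ?_⟩
      rintro ⟨c', a', b'⟩ ⟨e, hu', hw', h⟩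
      simp only at e hu' hw' h
      simp only [e] at h
      have := congrArg Subtype.val (huniq _ h.symm)
      obtain ⟨rfl, rfl, rfl⟩ := hinj _ _ _ _ _ _ this e
      rfl
  · have key : ∀ M N : (G.induce V).Subgraph,
        (fun c (e : Bool × Bool) => decide (∃ (hu : x c e.1 ∈ V) (hw : y c e.2 ∈ V),
          M.Adj ⟨x c e.1, hu⟩ ⟨y c e.2, hw⟩)) =
        (fun c e => decide (∃ (hu : x c e.1 ∈ V) (hw : y c e.2 ∈ V),
          N.Adj ⟨x c e.1, hu⟩ ⟨y c e.2, hw⟩)) → ∀ u w, P u.1 → M.Adj u w → N.Adj u w := by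
      rintro M N h ⟨u, hu⟩ ⟨w, hw⟩ hPu hM
      obtain ⟨c, a, b, rfl, rfl⟩ := hex u hu w hw hM.adj_sub hPu
      have h1 := congrFun (congrFun h c) (a, b)
      simp only [decide_eq_decide] at h1
      obtain ⟨_, _, h2⟩ := h1.1 ⟨hu, hw, hM⟩
      exact h2
    have key' : ∀ M N : (G.induce V).Subgraph,
        (fun c (e : Bool × Bool) => decide (∃ (hu : x c e.1 ∈ V) (hw : y c e.2 ∈ V),
          M.Adj ⟨x c e.1, hu⟩ ⟨y c e.2, hw⟩)) =
        (fun c e => decide (∃ (hu : x c e.1 ∈ V) (hw : y c e.2 ∈ V),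
          N.Adj ⟨x c e.1, hu⟩ ⟨y c e.2, hw⟩)) → ∀ u w, M.Adj u w → N.Adj u w := by
      intro M N h u w hM
      by_cases hPu : P u.1
      · exact key M N h u w hPu hM
      · have had := hM.symm.adj_sub
        exact (key M N h w u ((hP _ _ had).2 hPu) hM.symm).symm
    intro M N hM hN h
    refine SimpleGraph.Subgraph.ext ?_ ?_
    · rw [SimpleGraph.Subgraph.isSpanning_iff.1 hM.2, SimpleGraph.Subgraph.isSpanning_iff.1 hN.2]
    · funext u w
      exact propext ⟨key' M N h u w, key' N M h.symm u w⟩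
  · intro f hf
    rw [Finset.mem_coe, mem_cellMatchings_indicator] at hf
    obtain ⟨h0, h1, h2⟩ := hf
    let M : (G.induce V).Subgraph :=
      { verts := Set.univ
        Adj := fun u w => ∃ c a b, f c (a, b) = true ∧
          ((x c a = u.1 ∧ y c b = w.1) ∨ (x c a = w.1 ∧ y c b = u.1))
        adj_sub := by
          rintro ⟨u, hu⟩ ⟨w, hw⟩ ⟨c, a, b, -, ⟨rfl, rfl⟩ | ⟨rfl, rfl⟩⟩
          · exact hadj c a b
          · exact (hadj c a b).symm
        edge_vert := fun _ => Set.mem_univ _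
        symm := ⟨fun u w ⟨c, a, b, h, h'⟩ => ⟨c, a, b, h, h'.symm⟩⟩ }
    refine ⟨M, ?_, ?_⟩
    · rw [Set.mem_ofPred_eq, SimpleGraph.Subgraph.isPerfectMatching_iff]
      rintro ⟨v, hv⟩
      by_cases hPv : P v
      · obtain ⟨⟨c, a, b⟩, ⟨rfl, hf⟩, huniq⟩ := h1 v ⟨hv, hPv⟩
        refine ⟨⟨y c b, (h0 c a b hf).2.1⟩, ⟨c, a, b, hf, Or.inl ⟨rfl, rfl⟩⟩, ?_⟩
        rintro ⟨w, hw⟩ ⟨c', a', b', hf', ⟨e, rfl⟩ | ⟨rfl, e⟩⟩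
        · have := huniq (c', a', b') ⟨e, hf'⟩
          simp only [Prod.mk.injEq] at this
          obtain ⟨rfl, rfl, rfl⟩ := this
          rfl
        · exact absurd (e ▸ hPv) (hy c' b')
      · obtain ⟨⟨c, a, b⟩, ⟨rfl, hf⟩, huniq⟩ := h2 v ⟨hv, hPv⟩
        refine ⟨⟨x c a, (h0 c a b hf).1.1⟩, ⟨c, a, b, hf, Or.inr ⟨rfl, rfl⟩⟩, ?_⟩
        rintro ⟨w, hw⟩ ⟨c', a', b', hf', ⟨e, rfl⟩ | ⟨rfl, e⟩⟩
        · have := hx c' a'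
          rw [e] at this
          exact absurd this hPv
        · have := huniq (c', a', b') ⟨e, hf'⟩
          simp only [Prod.mk.injEq] at this
          obtain ⟨rfl, rfl, rfl⟩ := this
          rfl
    · funext c ⟨a, b⟩
      refine Bool.eq_iff_iff.2 ((@decide_eq_true_iff _ (_)).trans ?_)
      constructor
      · rintro ⟨hu, hw, c', a', b', hf', ⟨e1, e2⟩ | ⟨e1, e2⟩⟩
        · obtain ⟨rfl, rfl, rfl⟩ := hinj _ _ _ _ _ _ e1 e2
          exact hf'
        · simp only at e1
          exact absurd (e1 ▸ hx c' a') (hy c b)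
      · intro hf
        exact ⟨(h0 c a b hf).1.1, (h0 c a b hf).2.1, c, a, b, hf, Or.inl ⟨rfl, rfl⟩⟩

end graph

/-! ### The cells of the Aztec diamond. -/

section aztec

/-- In coordinates rotated by 45 degrees the diamond becomes a square. -/
lemma mem_aztecVertices_iff (n : ℕ) (i₀ j₀ : ℤ) (v : ℤ × ℤ) :
    v ∈ aztecVertices n i₀ j₀ ↔
      |v.1 - i₀ + (v.2 - j₀) + 1| ≤ n ∧ |v.1 - i₀ - (v.2 - j₀)| ≤ n := by
  obtain ⟨a, b⟩ := v
  simp only [aztecVertices, aztecFaces, faceVertices, Set.mem_ofPred_eq, Prod.exists, abs_le]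
  constructor
  · rintro ⟨i, j, h, h1, h2⟩
    rcases abs_cases (i - i₀) with h3 | h3 <;> rcases abs_cases (j - j₀) with h4 | h4 <;> omega
  · rintro ⟨h1, h2⟩
    -- Among the four faces at the vertex, this one is nearest to the centre.
    refine ⟨if i₀ ≤ a then a else a + 1, if j₀ ≤ b then b else b + 1, ?_, ?_, ?_⟩
    · split_ifs <;>
        rcases abs_cases (a - i₀) with h3 | h3 <;> rcases abs_cases (b - j₀) with h4 | h4 <;>
        rcases abs_cases (a + 1 - i₀) with h5 | h5 <;>
        rcases abs_cases (b + 1 - j₀) with h6 | h6 <;> omega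
    · split_ifs <;> omega
    · split_ifs <;> omega

/-- The lower left and upper right corners of the cell `(p, q)` of the Aztec diamond. -/
def diagCorner (n : ℕ) (i₀ j₀ : ℤ) (c : Fin n × Fin n) (a : Bool) : ℤ × ℤ :=
  (i₀ + c.1 + c.2 - n + a.toNat, j₀ + c.1 - c.2 - 1 + a.toNat)

/-- The upper left and lower right corners of the cell `(p, q)` of the Aztec diamond. -/
def antidiagCorner (n : ℕ) (i₀ j₀ : ℤ) (c : Fin n × Fin n) (b : Bool) : ℤ × ℤ :=
  (i₀ + c.1 + c.2 - n + b.toNat, j₀ + c.1 - c.2 - b.toNat)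

/-- The colour class of the vertices `diagCorner n i₀ j₀ c a`. -/
def IsDiagVertex (n : ℕ) (i₀ j₀ : ℤ) (v : ℤ × ℤ) : Prop :=
  (v.1 - i₀ + (v.2 - j₀) + 1 - n) % 2 = 0

lemma isDiagVertex_diagCorner (n : ℕ) (i₀ j₀ : ℤ) (c : Fin n × Fin n) (a : Bool) :
    IsDiagVertex n i₀ j₀ (diagCorner n i₀ j₀ c a) := by
  simp only [IsDiagVertex, diagCorner]; omega

lemma not_isDiagVertex_antidiagCorner (n : ℕ) (i₀ j₀ : ℤ) (c : Fin n × Fin n) (b : Bool) :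
    ¬ IsDiagVertex n i₀ j₀ (antidiagCorner n i₀ j₀ c b) := by
  simp only [IsDiagVertex, antidiagCorner]; omega

lemma diagCorner_left_injective (n : ℕ) (i₀ j₀ : ℤ) (a : Bool) :
    Function.Injective fun c => diagCorner n i₀ j₀ c a := by
  rintro ⟨p, q⟩ ⟨p', q'⟩ h
  simp only [diagCorner, Prod.mk.injEq, Fin.ext_iff] at h ⊢
  omega

lemma antidiagCorner_left_injective (n : ℕ) (i₀ j₀ : ℤ) (b : Bool) :
    Function.Injective fun c => antidiagCorner n i₀ j₀ c b := by
  rintro ⟨p, q⟩ ⟨p', q'⟩ h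
  simp only [antidiagCorner, Prod.mk.injEq, Fin.ext_iff] at h ⊢
  omega

lemma exists_diagCorner_iff (n : ℕ) (i₀ j₀ : ℤ) (a : Bool) (v : ℤ × ℤ) :
    (∃ c, diagCorner n i₀ j₀ c a = v) ↔ IsDiagVertex n i₀ j₀ v ∧
      |v.1 - i₀ - (v.2 - j₀)| < n ∧ |v.1 - i₀ + (v.2 - j₀) + 2 - 2 * a.toNat| < n := by
  obtain ⟨s, t⟩ := v
  simp only [IsDiagVertex, diagCorner, Prod.exists, Prod.mk.injEq, abs_lt]
  constructor
  · rintro ⟨p, q, h1, h2⟩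
    omega
  · rintro ⟨h1, h2, h3⟩
    -- The parity condition makes these halvings exact.
    refine ⟨⟨((s - i₀ + (t - j₀) + 1 + n) / 2 - a.toNat).toNat, by omega⟩,
      ⟨((s - i₀ - (t - j₀) - 1 + n) / 2).toNat, by omega⟩, ?_, ?_⟩ <;>
    simp only <;> omega

lemma exists_antidiagCorner_iff (n : ℕ) (i₀ j₀ : ℤ) (b : Bool) (v : ℤ × ℤ) :
    (∃ c, antidiagCorner n i₀ j₀ c b = v) ↔ ¬ IsDiagVertex n i₀ j₀ v ∧
      |v.1 - i₀ + (v.2 - j₀) + 1| < n ∧ |v.1 - i₀ - (v.2 - j₀) + 1 - 2 * b.toNat| < n := by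
  obtain ⟨s, t⟩ := v
  simp only [IsDiagVertex, antidiagCorner, Prod.exists, Prod.mk.injEq, abs_lt]
  constructor
  · rintro ⟨p, q, h1, h2⟩
    omega
  · rintro ⟨h1, h2, h3⟩
    refine ⟨⟨((s - i₀ + (t - j₀) + n) / 2).toNat, by omega⟩,
      ⟨((s - i₀ - (t - j₀) + n) / 2 - b.toNat).toNat, by omega⟩, ?_, ?_⟩ <;>
    simp only <;> omega

open Classical in
lemma cornerSum_one_of_injective {C α : Type*} [Fintype C] [DecidableEq α] (x : C → Bool → α)
    (hx : ∀ a, Function.Injective fun c => x c a) (v : α) :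
    cornerSum x (fun _ _ => 1) v =
      (if ∃ c, x c true = v then 1 else 0) + if ∃ c, x c false = v then 1 else 0 := by
  have h : ∀ a, (∑ c, if x c a = v then 1 else 0) = if ∃ c, x c a = v then 1 else 0 := by
    intro a
    split_ifs with h
    · obtain ⟨c, rfl⟩ := h
      simp [(hx a).eq_iff]
    · push Not at h
      simp [h]
  simp only [cornerSum, Fintype.sum_bool, Finset.sum_add_distrib, h]

open Classical in
/-- The matchings of an Aztec diamond of order `m ∈ {n, n - 1}` in terms of the cells of the Aztec
diamond of order `n`. -/
lemma aztecMatchingCount_eq_card (n m : ℕ) (hm : m ≤ n) (i₀ j₀ : ℤ) :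
    aztecMatchingCount m i₀ j₀ =
      Finset.card (cellMatchings (diagCorner n i₀ j₀) (antidiagCorner n i₀ j₀)
        (fun v => if v ∈ aztecVertices m i₀ j₀ ∧ IsDiagVertex n i₀ j₀ v then 1 else 0)
        (fun v => if v ∈ aztecVertices m i₀ j₀ ∧ ¬ IsDiagVertex n i₀ j₀ v then 1 else 0)) := by
  refine ncard_perfectMatchings_induce squareGrid _ _ _ _ (isDiagVertex_diagCorner n i₀ j₀)
    (not_isDiagVertex_antidiagCorner n i₀ j₀) ?_ ?_ ?_ ?_
  · rintro ⟨s, t⟩ ⟨s', t'⟩ h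
    simp only [squareGrid, IsDiagVertex] at h ⊢
    omega
  · rintro ⟨p, q⟩ a b
    simp only [squareGrid, diagCorner, antidiagCorner]
    cases a <;> cases b <;> simp
  · rintro ⟨p, q⟩ a b ⟨p', q'⟩ a' b' h1 h2
    simp only [diagCorner, antidiagCorner, Prod.mk.injEq, Fin.ext_iff] at h1 h2 ⊢
    cases a <;> cases b <;> cases a' <;> cases b' <;> simp at h1 h2 ⊢ <;> omega
  · rintro ⟨s, t⟩ hu ⟨s', t'⟩ hw h hP
    rw [mem_aztecVertices_iff, abs_le, abs_le] at hu hw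
    simp only [squareGrid, IsDiagVertex] at h hP hu hw
    -- The direction of an edge determines which corners of its cell are its ends.
    have : ∃ a b : Bool, s' - s = b.toNat - a.toNat ∧ t' - t = 1 - a.toNat - b.toNat := by
      rcases h with ⟨h1, h2 | h2⟩ | ⟨h1, h2 | h2⟩
      · exact ⟨false, false, by simp; omega⟩
      · exact ⟨true, true, by simp; omega⟩
      · exact ⟨false, true, by simp; omega⟩
      · exact ⟨true, false, by simp; omega⟩
    obtain ⟨a, b, h1, h2⟩ := this
    have ha : a.toNat ≤ 1 := Bool.toNat_le a
    have hb : b.toNat ≤ 1 := Bool.toNat_le b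
    -- The two strict bounds concern one rotated coordinate of each end; each has the parity of `n -
    -- 1`, so `≤ n` improves to `< n`.
    obtain ⟨c, hc⟩ := (exists_diagCorner_iff n i₀ j₀ a (s, t)).2 (by
      simp only [IsDiagVertex, abs_lt]; omega)
    refine ⟨c, a, b, hc, ?_⟩
    simp only [diagCorner, antidiagCorner, Prod.mk.injEq] at hc ⊢
    omega

/-! ### The recursion in the order, and its solution. -/

/-- The vertices in the colour class of the vertices `diagCorner n i₀ j₀ c a`. -/
def diagVertices (n : ℕ) (i₀ j₀ : ℤ) : Finset (ℤ × ℤ) :=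
  Finset.univ.image fun c : Fin (n + 1) × Fin n =>
    (i₀ + c.1 + c.2 - n, j₀ + c.1 - c.2 - 1)

lemma card_diagVertices (n : ℕ) (i₀ j₀ : ℤ) : (diagVertices n i₀ j₀).card = (n + 1) * n := by
  rw [diagVertices, Finset.card_image_of_injective]
  · simp
  · rintro ⟨p, q⟩ ⟨p', q'⟩ h
    simp only [Prod.mk.injEq, Fin.ext_iff] at h ⊢
    omega

lemma diagCorner_mem_diagVertices (n : ℕ) (i₀ j₀ : ℤ) (c : Fin n × Fin n) (a : Bool) :
    diagCorner n i₀ j₀ c a ∈ diagVertices n i₀ j₀ := by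
  have ha : a.toNat ≤ 1 := Bool.toNat_le a
  refine Finset.mem_image.2 ⟨(⟨c.1 + a.toNat, by omega⟩, c.2), Finset.mem_univ _, ?_⟩
  simp only [diagCorner, Prod.mk.injEq]
  omega

lemma mem_aztecVertices_of_mem_diagVertices {n : ℕ} {i₀ j₀ : ℤ} {v : ℤ × ℤ}
    (hv : v ∈ diagVertices n i₀ j₀) :
    v ∈ aztecVertices n i₀ j₀ ∧ IsDiagVertex n i₀ j₀ v := by
  obtain ⟨⟨p, q⟩, -, rfl⟩ := Finset.mem_image.1 hv
  rw [mem_aztecVertices_iff, abs_le, abs_le]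
  simp only [IsDiagVertex]
  omega

lemma aztecMatchingCount_succ (n : ℕ) (i₀ j₀ : ℤ) :
    aztecMatchingCount (n + 1) i₀ j₀ = 2 ^ (n + 1) * aztecMatchingCount n i₀ j₀ := by
  classical
  have h01 : ∀ (p : Prop) [Decidable p], (if p then 1 else 0 : ℕ) ≤ 1 := fun p _ => by split_ifs <;> simp
  have h := two_pow_mul_card_cellMatchings
    (diagCorner (n + 1) i₀ j₀) (antidiagCorner (n + 1) i₀ j₀)
    (fun v => if v ∈ aztecVertices (n + 1) i₀ j₀ ∧ IsDiagVertex (n + 1) i₀ j₀ v then 1 else 0)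
    (fun v => if v ∈ aztecVertices (n + 1) i₀ j₀ ∧ ¬ IsDiagVertex (n + 1) i₀ j₀ v then 1 else 0)
    (fun v => if v ∈ aztecVertices n i₀ j₀ ∧ IsDiagVertex (n + 1) i₀ j₀ v then 1 else 0)
    (fun v => if v ∈ aztecVertices n i₀ j₀ ∧ ¬ IsDiagVertex (n + 1) i₀ j₀ v then 1 else 0)
    (fun _ => h01 _) (fun _ => h01 _) (fun _ => h01 _) (fun _ => h01 _) ?_ ?_
    (diagVertices (n + 1) i₀ j₀) (diagCorner_mem_diagVertices (n + 1) i₀ j₀)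
  -- The exponents are `(n + 1) ^ 2` cells and `(n + 2) * (n + 1)` vertices of one colour; they
  -- differ by `n + 1`.
  · rw [← aztecMatchingCount_eq_card (n + 1) (n + 1) le_rfl,
      ← aztecMatchingCount_eq_card (n + 1) n n.le_succ,
      Finset.sum_congr rfl fun v hv => if_pos (mem_aztecVertices_of_mem_diagVertices hv),
      Finset.sum_const, card_diagVertices, smul_eq_mul, mul_one, Fintype.card_prod,
      Fintype.card_fin, add_one_mul (n + 1) (n + 1), pow_add, mul_assoc] at h
    exact Nat.eq_of_mul_eq_mul_left (by positivity) h
  · intro v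
    -- Vertices with two corners lie in both diamonds, those with one corner only in the larger.
    rw [cornerSum_one_of_injective _ (diagCorner_left_injective (n + 1) i₀ j₀)]
    simp only [exists_diagCorner_iff, mem_aztecVertices_iff, IsDiagVertex, abs_le, abs_lt,
      Bool.toNat_true, Bool.toNat_false]
    split_ifs <;> omega
  · intro v
    rw [cornerSum_one_of_injective _ (antidiagCorner_left_injective (n + 1) i₀ j₀)]
    simp only [exists_antidiagCorner_iff, mem_aztecVertices_iff, IsDiagVertex, abs_le, abs_lt,
      Bool.toNat_true, Bool.toNat_false]
    split_ifs <;> omega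

lemma aztecMatchingCount_zero (i₀ j₀ : ℤ) : aztecMatchingCount 0 i₀ j₀ = 1 := by
  classical
  rw [aztecMatchingCount_eq_card 0 0 le_rfl, Finset.card_eq_one]
  -- Order `0` has neither cells nor vertices, so the empty edge set is the only matching.
  refine ⟨fun c => c.1.elim0, Finset.eq_singleton_iff_unique_mem.2 ⟨?_, fun f _ => ?_⟩⟩
  · rw [mem_cellMatchings_indicator]
    have hv : ∀ v, v ∉ aztecVertices 0 i₀ j₀ ∨ False := by
      intro v
      rw [mem_aztecVertices_iff, abs_le, abs_le]
      push_cast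
      omega
    exact ⟨fun c => c.1.elim0, fun v h => ((hv v).elim (fun k => k h.1) id).elim,
      fun v h => ((hv v).elim (fun k => k h.1) id).elim⟩
  · funext c
    exact c.1.elim0

lemma aztecMatchingCount_eq_two_pow (n : ℕ) (i₀ j₀ : ℤ) :
    aztecMatchingCount n i₀ j₀ = 2 ^ (n * (n + 1) / 2) := by
  induction n with
  | zero => simpa using aztecMatchingCount_zero i₀ j₀
  | succ n ih =>
    rw [aztecMatchingCount_succ, ih, ← pow_add]
    congr 1
    rw [show (n + 1) * (n + 1 + 1) = n * (n + 1) + (n + 1) * 2 by ring,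
      Nat.add_mul_div_right _ _ two_pos, add_comm]

end aztec

theorem mainTheorem9 (i₀ j₀ : ℤ) :
    (∀ n : ℕ, aztecMatchingCount n i₀ j₀ = 2 ^ (n * (n + 1) / 2)) ∧
    (∀ n : ℕ, 2 ≤ n →
      aztecMatchingCount n i₀ j₀ * aztecMatchingCount (n - 2) i₀ j₀ =
        2 * aztecMatchingCount (n - 1) i₀ j₀ ^ 2) := by
  refine ⟨fun n => aztecMatchingCount_eq_two_pow n i₀ j₀, fun n hn => ?_⟩
  obtain ⟨k, rfl⟩ := Nat.exists_eq_add_of_le' hn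
  -- The ratio of consecutive counts doubles from one order to the next.
  rw [show k + 2 - 2 = k by omega, show k + 2 - 1 = k + 1 by omega,
    aztecMatchingCount_succ (k + 1), aztecMatchingCount_succ k]
  ring
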